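/- Let $(X,\mu)$ be a standard probability space and let $E$ be a countable Borel measure preserving equivalence relation on it, i.e. an equivalence relation that is a Borel subset of $X\times X$, has countable classes, and is such that every partial Borel injection whose graph is contained in $E$ is measure preserving. The full group $[[E]]$ is the group of measure preserving automorphisms of $(X,\mu)$ whose graphs are contained in $E$, automorphisms that agree almost everywhere being identified; its uniform topology is given by the metric $d(S,T)=\mu\{x : Sx\neq Tx\}$. We say that $E$ orbitally contains a group $N$ if there is an essentially free measure preserving action of $N$ on $(X,\mu)$ such that the $N$-orbit of almost every point is contained in the $E$-class of that point. A representation of a group $\Gamma$ is a homomorphism $\pi$ from $\Gamma$ to the group of bounded invertible operators on a complex Hilbert space $\mathcal H$. It is uniformly bounded if $\sup_{g\in\Gamma}\|\pi(g)\|<\infty$, and unitarizable if there are a bounded operator $B$ on $\mathcal H$ and a constant $C>0$ such that $\pi(g)^*B\pi(g)=B$ for all $g\in\Gamma$ and $\langle Bv,v\rangle\ge C\|v\|^2$ for all $v\in\mathcal H$. The group $\Gamma$ is unitarizable if each of its uniformly bounded representations is unitarizable. A unitary representation $\rho$ of $\Gamma$ on $\mathcal H$ is strongly rigid if for every $\varepsilon>0$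 there is $\delta>0$ such that every unitary representation $\rho_1$ of $\Gamma$ on $\mathcal H$ with $\sup_{g\in\Gamma}\|\rho(g)-\rho_1(g)\|<\delta$ is conjugate to $\rho$ by a unitary operator $U$ with $\|\mathrm{Id}-U\|<\varepsilon$. Let $G$ be a countable subgroup of $[[E]]$ that is dense in the uniform topology. Then: 1. if $E$ orbitally contains a countable non-unitarizable group, then $G$ is non-unitarizable; 2. if $E$ orbitally contains a countable group that has a unitary representation which is not strongly rigid, then $G$ has a unitary representation which is not strongly rigid. -/

import Mathlib

open MeasureTheory
open scoped ComplexOrder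

universe u v w

/-! ## Uniformly bounded and unitarizable representations -/

section Unitarizability

variable {G : Type w} [Group G] {H : Type v} [NormedAddCommGroup H] [InnerProductSpace ℂ H]

/-- A representation by bounded invertible operators is uniformly bounded if the operator norms
`‖π g‖` have a common bound. -/
def UniformlyBoundedRep (π : G →* (H →L[ℂ] H)ˣ) : Prop :=
  ∃ K : ℝ, ∀ g : G, ‖(π g : H →L[ℂ] H)‖ < K

/-- A representation `π` is unitarizable if there are a bounded operator `B` and a constant `C > 0`
with `π(g)* B π(g) = B` for all `g` and `⟨B v, v⟩ ≥ C ‖v‖²` for all `v`. The last inequality is one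
between complex numbers, so it says that `⟨B v, v⟩` is real and at least `C ‖v‖²`. -/
def UnitarizableRep [CompleteSpace H] (π : G →* (H →L[ℂ] H)ˣ) : Prop :=
  ∃ (B : H →L[ℂ] H) (C : ℝ), 0 < C ∧
    (∀ g : G, ContinuousLinearMap.adjoint (π g : H →L[ℂ] H) ∘L B ∘L (π g : H →L[ℂ] H) = B) ∧
    ∀ v : H, ((C * ‖v‖ ^ 2 : ℝ) : ℂ) ≤ inner ℂ (B v) v

end Unitarizability

/-- A group is unitarizable if each of its uniformly bounded representations on a complex Hilbert
space is unitarizable. -/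
def UnitarizableGroup (G : Type w) [Group G] : Prop :=
  ∀ (H : Type v) [NormedAddCommGroup H] [InnerProductSpace ℂ H] [CompleteSpace H]
    (π : G →* (H →L[ℂ] H)ˣ), UniformlyBoundedRep π → UnitarizableRep π

/-! ## Strongly rigid unitary representations -/

section Rigidity

variable {G : Type w} [Group G] {H : Type v} [NormedAddCommGroup H] [InnerProductSpace ℂ H]
  [CompleteSpace H]

/-- The uniform distance `sup_g ‖ρ g - ρ₁ g‖` between two unitary representations on the same
Hilbert space. (The supremum is over a family bounded by `2`.) -/
noncomputable def unitaryRepDist (ρ ρ₁ : G →* unitary (H →L[ℂ] H)) : ℝ :=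
  ⨆ g : G, ‖(ρ g : H →L[ℂ] H) - (ρ₁ g : H →L[ℂ] H)‖

/-- A unitary representation `ρ` is strongly rigid if for every `ε > 0` there is `δ > 0` such that
every unitary representation on the same Hilbert space at distance less than `δ` from `ρ` is
conjugate to `ρ` by a unitary operator `U` with `‖1 - U‖ < ε`. -/
def StronglyRigid (ρ : G →* unitary (H →L[ℂ] H)) : Prop :=
  ∀ ε : ℝ, 0 < ε → ∃ δ : ℝ, 0 < δ ∧ ∀ ρ₁ : G →* unitary (H →L[ℂ] H), unitaryRepDist ρ ρ₁ < δ →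
    ∃ U : unitary (H →L[ℂ] H), ‖(1 : H →L[ℂ] H) - (U : H →L[ℂ] H)‖ < ε ∧
      ∀ g : G, U * ρ g * U⁻¹ = ρ₁ g

end Rigidity

/-- The group `G` has a unitary representation on a complex Hilbert space that is not strongly
rigid. -/
def HasNotStronglyRigidRep (G : Type w) [Group G] : Prop :=
  ∃ (H : Type v) (_ : NormedAddCommGroup H) (_ : InnerProductSpace ℂ H) (_ : CompleteSpace H)
    (ρ : G →* unitary (H →L[ℂ] H)), ¬ StronglyRigid ρ

/-! ## Measure preserving equivalence relations -/

section Relations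

variable {X : Type u} [MeasurableSpace X]

/-- `E` is a countable Borel measure preserving equivalence relation on `(X, μ)`: it is a measurable
subset of `X × X`, its classes are countable, and every partial Borel injection (here: the
restriction to a measurable set `A` of a measurable map `ψ` that is injective on `A`) whose graph is
contained in `E` is measure preserving, as a map from its domain onto its image. -/
structure IsCountablePMPRelation (E : Setoid X) (μ : Measure X) : Prop where
  measurableSet : MeasurableSet {p : X × X | E p.1 p.2}
  countable_classes : ∀ x : X, {y : X | E x y}.Countable
  measurePreserving : ∀ (A : Set X) (ψ : X → X), MeasurableSet A → Measurable ψ → Set.InjOn ψ A →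
    (∀ x ∈ A, E x (ψ x)) → MeasurePreserving ψ (μ.restrict A) (μ.restrict (ψ '' A))

/-- `E` orbitally contains `N`: there is an essentially free measure preserving action of `N` on
`(X, μ)` such that the orbit of almost every point is contained in its `E`-class. -/
def OrbitallyContains (E : Setoid X) (μ : Measure X) (N : Type w) [Group N] : Prop :=
  ∃ _ : MulAction N X,
    (∀ n : N, MeasurePreserving (fun x : X => n • x) μ μ) ∧
    (∀ᵐ x ∂μ, ∀ n : N, n • x = x → n = 1) ∧
    (∀ᵐ x ∂μ, ∀ n : N, E x (n • x))

/-! ## The full group with the uniform topology -/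

/-- The group of measure preserving Borel automorphisms of `(X, μ)` whose graph is contained in `E`,
before identification of automorphisms that agree almost everywhere. -/
def preFullSubgroup (E : Setoid X) (μ : Measure X) : Subgroup (Equiv.Perm X) where
  carrier := {T | MeasurePreserving T μ μ ∧ MeasurePreserving T.symm μ μ ∧ ∀ x, E x (T x)}
  one_mem' := ⟨MeasurePreserving.id μ, MeasurePreserving.id μ, fun x => E.refl x⟩
  mul_mem' := by
    rintro S T ⟨hS, hS', hSE⟩ ⟨hT, hT', hTE⟩
    exact ⟨hS.comp hT, hT'.comp hS', fun x => E.trans (hTE x) (hSE (T x))⟩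
  inv_mem' := by
    rintro T ⟨hT, hT', hTE⟩
    refine ⟨hT', hT, fun x => ?_⟩
    have h := hTE (T.symm x)
    rw [Equiv.apply_symm_apply] at h
    exact E.symm h

/-- The elements of `preFullSubgroup E μ`, as a type. -/
def PreFullGroup (E : Setoid X) (μ : Measure X) : Type u := preFullSubgroup E μ

namespace PreFullGroup

variable {E : Setoid X} {μ : Measure X}

instance : Group (PreFullGroup E μ) := inferInstanceAs (Group (preFullSubgroup E μ))

/-- The underlying bijection of `X`. -/
def toPerm (T : PreFullGroup E μ) : Equiv.Perm X := T.1

theorem measure_preimage (T : PreFullGroup E μ) (s : Set X) : μ (T.toPerm ⁻¹' s) = μ s :=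
  MeasurePreserving.measure_preimage_equiv
    (f := ⟨T.toPerm, T.2.1.measurable, T.2.2.1.measurable⟩) T.2.1 s

variable [IsProbabilityMeasure μ]

/-- The uniform distance `μ {x | T x ≠ S x}`. It vanishes exactly when `T = S` almost everywhere. -/
noncomputable instance : PseudoMetricSpace (PreFullGroup E μ) where
  dist T S := μ.real {x | T.toPerm x ≠ S.toPerm x}
  dist_self T := by simp
  dist_comm T S := by simp only [ne_comm]
  dist_triangle R S T := by
    refine (measureReal_mono ?_).trans (measureReal_union_le _ _)
    intro x hx
    by_contra h
    simp only [Set.mem_union, Set.mem_ofPred_eq, not_or, not_not] at h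
    exact hx (h.1.trans h.2)

theorem dist_def (T S : PreFullGroup E μ) : dist T S = μ.real {x | T.toPerm x ≠ S.toPerm x} := rfl

theorem dist_mul_left (R S T : PreFullGroup E μ) : dist (R * S) (R * T) = dist S T := by
  have h : ∀ x, ((R * S).toPerm x ≠ (R * T).toPerm x) = (S.toPerm x ≠ T.toPerm x) := fun x =>
    propext (R.toPerm.injective.ne_iff (x := S.toPerm x) (y := T.toPerm x))
  simp only [dist_def, h]

theorem dist_mul_right (R S T : PreFullGroup E μ) : dist (S * R) (T * R) = dist S T :=
  congrArg ENNReal.toReal (R.measure_preimage {x | S.toPerm x ≠ T.toPerm x})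

theorem dist_inv (S T : PreFullGroup E μ) : dist S⁻¹ T⁻¹ = dist S T := by
  rw [← dist_mul_left S S⁻¹ T⁻¹, ← dist_mul_right T]
  simp [dist_comm]

instance : IsTopologicalGroup (PreFullGroup E μ) where
  continuous_mul := by
    refine LipschitzWith.continuous (K := 2) (LipschitzWith.of_dist_le_mul ?_)
    rintro ⟨S, T⟩ ⟨S', T'⟩
    have h := dist_triangle (S * T) (S' * T) (S' * T')
    rw [dist_mul_left, dist_mul_right] at h
    have h1 : dist S S' ≤ dist (S, T) (S', T') := le_max_left _ _
    have h2 : dist T T' ≤ dist (S, T) (S', T') := le_max_right _ _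
    simp only [NNReal.coe_ofNat]
    linarith
  continuous_inv := (Isometry.of_dist_eq dist_inv).continuous

end PreFullGroup

/-- The full group of `E`: measure preserving automorphisms with graph contained in `E`, two
automorphisms being identified when they agree almost everywhere (that is, when their uniform
distance is `0`). As a separation quotient it carries the quotient group structure and the metric
given by the uniform distance, whose topology is the uniform topology. -/
abbrev FullGroup (E : Setoid X) (μ : Measure X) [IsProbabilityMeasure μ] : Type u :=
  SeparationQuotient (PreFullGroup E μ)

end Relations

/-! ## Unitary parts of operators close to the identity -/

section Polar

variable {A : Type*} [CStarAlgebra A] [PartialOrder A] [StarOrderedRing A]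

/-! The proof induces representations from `N` through a measured cocycle and recovers them as
limits along `G`. Let `Γ` be the countable subgroup of the full group generated by `G` and the image
of `N`, realized by an honest action on `X`. Let `Y` consist of the pairs of a point `x` and an
`N`-orbit inside `Γ • x`. An element of `Γ` moves `x` and keeps the orbit. Representatives of the
orbits are compared by a unique element of `N`, because `N` acts freely, and this gives a cocycle
from `Γ` on `Y` to `N`. A representation `π` of `N` on `H` thus induces one of `Γ`, hence of `G`, on
`L²(Y, H)`, with the same norm bound.

The base piece `{(x, N • x)}` has measure `1`, and the functions constant on it form an isometric
copy of `H`. If `g ∈ G` is uniformly close to `n ∈ N`, then `g • x = n • x` for most `x`; at such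
points `g` preserves the base piece and has cocycle value `n`. By density of `G`, the induced
operators therefore converge to `π n` on this copy of `H` (`approxBy_inducedRep`,
`exists_pmpCocycle_of_dense`).

Strong convergence suffices to compress information from `L²(Y, H)` to `H`. An invariant form for
the induced representation compresses to one for `π` (`UnitarizableRep.of_approxBy`). A unitary near
the identity that conjugates two induced representations compresses to an intertwiner near the
identity, whose polar part is the desired unitary (`exists_unitary_conj_of_approxBy`). -/

theorem norm_one_sub_le_norm_one_sub_sq {p : A} (hp : 0 ≤ p) : ‖1 - p‖ ≤ ‖1 - p ^ 2‖ := by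
  have hsa : IsSelfAdjoint p := .of_nonneg hp
  have h1 : cfc (fun x : ℝ => 1 - x) p = 1 - p := by
    rw [cfc_sub (fun _ : ℝ => (1 : ℝ)) (fun x => x) p, cfc_const_one ℝ p, cfc_id' ℝ p]
  have h2 : cfc (fun x : ℝ => 1 - x ^ 2) p = 1 - p ^ 2 := by
    rw [cfc_sub (fun _ : ℝ => (1 : ℝ)) (fun x => x ^ 2) p, cfc_const_one ℝ p, cfc_pow_id p 2]
  rw [← h1, ← h2]
  refine norm_cfc_le (norm_nonneg _) fun x hx => ?_
  refine le_trans ?_ (norm_apply_le_norm_cfc (fun x : ℝ => 1 - x ^ 2) p hx)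
  have hx0 : 0 ≤ x := spectrum_nonneg_of_nonneg hp hx
  have : (1 : ℝ) - x ^ 2 = (1 - x) * (1 + x) := by ring
  rw [this, norm_mul]
  refine le_mul_of_one_le_right (norm_nonneg _) ?_
  rw [Real.norm_eq_abs, abs_of_nonneg (by linarith)]
  linarith

/-- The unitary part of an element at distance less than `1` from the identity is close to the
identity, and it intertwines the unitaries that the element intertwines. -/
theorem exists_unitary_near_of_norm_one_sub_lt (V : A) (hV : ‖1 - V‖ < 1) :
    ∃ U : unitary A, ‖1 - (U : A)‖ ≤ 4 * ‖1 - V‖ ∧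
      ∀ a b : A, V * a = b * V → V * star a = star b * V → (U : A) * a = b * U := by
  have hVu : IsUnit V := by
    have := isUnit_one_sub_of_norm_lt_one hV
    rwa [sub_sub_cancel] at this
  -- The unitary is the polar part `V |V|⁻¹`.
  set P := CFC.abs V with hP
  have hP0 : 0 ≤ P := CFC.abs_nonneg V
  have hPP : P * P = star V * V := CFC.abs_mul_abs V
  have hPu : IsUnit P := by
    rw [← isUnit_mul_self_iff, hPP]
    exact hVu.star.mul hVu
  obtain ⟨p, hp⟩ := hPu
  have hps : star (p : A) = p := by rw [hp]; exact (IsSelfAdjoint.of_nonneg hP0).star_eq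
  have hpis : star (↑p⁻¹ : A) = ↑p⁻¹ := by
    rw [← Units.coe_star, star_inv]
    congr 2
    exact Units.ext hps
  have hWu : IsUnit (V * ↑p⁻¹) := hVu.mul p⁻¹.isUnit
  have hW : V * ↑p⁻¹ ∈ unitary A := by
    refine hWu.mem_unitary_of_star_mul_self ?_
    rw [star_mul, hpis, mul_assoc, ← mul_assoc (star V), ← hPP, ← hp]
    simp
  have hWp : V * ↑p⁻¹ * P = V := by rw [← hp]; simp [mul_assoc]
  refine ⟨⟨V * ↑p⁻¹, hW⟩, ?_, ?_⟩
  · change ‖1 - V * ↑p⁻¹‖ ≤ _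
    have hstar : ‖1 - star V‖ = ‖1 - V‖ := by
      rw [← norm_star, star_sub, star_star, star_one]
    have hVn : ‖star V‖ ≤ 2 := by
      have h1 : ‖(1 : A)‖ ≤ 1 := by
        rcases subsingleton_or_nontrivial A with h | h
        · rw [Subsingleton.elim (1 : A) 0, norm_zero]; exact zero_le_one
        · exact CStarRing.norm_one.le
      have : star V = 1 - (1 - star V) := by abel
      rw [this]
      exact (norm_sub_le _ _).trans (by linarith)
    -- The factor is `1 + ‖star V‖ ≤ 3`; the term `1 - V` in the splitting of `1 - V |V|⁻¹` below
    -- brings it to `4`.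
    have hPn : ‖1 - P‖ ≤ 3 * ‖1 - V‖ := by
      refine (norm_one_sub_le_norm_one_sub_sq hP0).trans ?_
      have : 1 - P ^ 2 = (1 - star V) + star V * (1 - V) := by
        rw [sq, hPP]; noncomm_ring
      rw [this]
      refine (norm_add_le _ _).trans ?_
      have := norm_mul_le (star V) (1 - V)
      nlinarith [norm_nonneg (1 - V)]
    have : 1 - V * ↑p⁻¹ = (1 - V) - (V * ↑p⁻¹) * (1 - P) := by
      rw [mul_sub, hWp]; noncomm_ring
    rw [this]
    refine (norm_sub_le _ _).trans ?_
    rw [CStarRing.norm_mem_unitary_mul _ hW]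
    linarith
  · intro a b h1 h2
    change V * ↑p⁻¹ * a = b * (V * ↑p⁻¹)
    have h3 : a * star V = star V * b := by simpa using (congrArg star h2)
    -- Both intertwining relations are needed here: `V* V a = V* b V = a V* V`. Commutation then
    -- passes to `|V|` by functional calculus.
    have hc : Commute (star V * V) a := by
      rw [Commute, SemiconjBy, mul_assoc, h1, ← mul_assoc, ← h3, mul_assoc]
    have hcP : Commute P a := by
      rw [hP, CFC.abs, CFC.sqrt_eq_cfc]
      exact hc.cfc_nnreal _
    rw [← hp] at hcP
    have := hcP.units_inv_left.eq
    rw [mul_assoc, this, ← mul_assoc, h1, mul_assoc]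

end Polar

/-! ## Unitarizability and strong rigidity through an almost invariant embedding -/

section Transfer

variable {N Γ : Type*} [Group N] [Group Γ]
variable {H K : Type*} [NormedAddCommGroup H] [InnerProductSpace ℂ H] [CompleteSpace H]
  [NormedAddCommGroup K] [InnerProductSpace ℂ K] [CompleteSpace K]

/-- `J` is approximately equivariant from `π` to `ρ` along `S`: on each vector, `ρ (S n k) ∘ J` tends
to `J ∘ π n` as `k` tends to infinity. -/
def ApproxBy (S : N → ℕ → Γ) (π : N → H →L[ℂ] H) (ρ : Γ → K →L[ℂ] K) (J : H →L[ℂ] K) : Prop :=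
  ∀ n v, Filter.Tendsto (fun k => ρ (S n k) (J v)) Filter.atTop (nhds (J (π n v)))

/-- The compressed form `J* B J` works: `⟨B ρ(S n k) J v, ρ(S n k) J w⟩` does not depend on `k` by
invariance of `B`, and its limit is `⟨B J π(n) v, J π(n) w⟩`. Positivity survives because `J` is
isometric. -/
theorem UnitarizableRep.of_approxBy {π : N →* (H →L[ℂ] H)ˣ} {ρ : Γ →* (K →L[ℂ] K)ˣ}
    {J : H →ₗᵢ[ℂ] K} {S : N → ℕ → Γ}
    (hJ : ApproxBy S (fun n => (π n : H →L[ℂ] H)) (fun g => (ρ g : K →L[ℂ] K))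
      J.toContinuousLinearMap) (hρ : UnitarizableRep ρ) : UnitarizableRep π := by
  obtain ⟨B, C, hC, hB, hpos⟩ := hρ
  let j : H →L[ℂ] K := J.toContinuousLinearMap
  refine ⟨ContinuousLinearMap.adjoint j ∘L B ∘L j, C, hC, fun n => ?_, fun v => ?_⟩
  · refine ContinuousLinearMap.ext fun v => ext_inner_right ℂ fun w => ?_
    simp only [ContinuousLinearMap.comp_apply, ContinuousLinearMap.adjoint_inner_left]
    have h1 : Filter.Tendsto (fun k => inner ℂ (B ((ρ (S n k) : K →L[ℂ] K) (j v)))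
        ((ρ (S n k) : K →L[ℂ] K) (j w))) Filter.atTop
        (nhds (inner ℂ (B (j ((π n : H →L[ℂ] H) v))) (j ((π n : H →L[ℂ] H) w)))) :=
      ((B.continuous.tendsto _).comp (hJ n v)).inner (hJ n w)
    refine tendsto_nhds_unique h1 (tendsto_const_nhds.congr fun k => ?_)
    have h2 : ContinuousLinearMap.adjoint (ρ (S n k) : K →L[ℂ] K)
        (B ((ρ (S n k) : K →L[ℂ] K) (j v))) = B (j v) :=
      congrArg (fun T : K →L[ℂ] K => T (j v)) (hB (S n k))
    rw [← h2, ContinuousLinearMap.adjoint_inner_left]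
  · simp only [ContinuousLinearMap.comp_apply, ContinuousLinearMap.adjoint_inner_left]
    have := hpos (J v)
    rwa [J.norm_map] at this

/-- If unitary representations `ρ`, `ρ₁` are conjugate by a unitary near the identity, then so are
the unitary representations `σ`, `σ₁` that they approximate. -/
theorem exists_unitary_conj_of_approxBy {σ σ₁ : N →* unitary (H →L[ℂ] H)}
    {ρ ρ₁ : Γ →* unitary (K →L[ℂ] K)} {J : H →ₗᵢ[ℂ] K} {S : N → ℕ → Γ}
    (hJ : ApproxBy S (fun n => (σ n : H →L[ℂ] H)) (fun g => (ρ g : K →L[ℂ] K))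
      J.toContinuousLinearMap)
    (hJ₁ : ApproxBy S (fun n => (σ₁ n : H →L[ℂ] H)) (fun g => (ρ₁ g : K →L[ℂ] K))
      J.toContinuousLinearMap)
    (U : unitary (K →L[ℂ] K)) (hU : ∀ g, U * ρ g * U⁻¹ = ρ₁ g)
    {η : ℝ} (hη : η < 1) (hUη : ‖(1 : K →L[ℂ] K) - (U : K →L[ℂ] K)‖ ≤ η) :
    ∃ W : unitary (H →L[ℂ] H), ‖(1 : H →L[ℂ] H) - (W : H →L[ℂ] H)‖ ≤ 4 * η ∧
      ∀ n, W * σ n * W⁻¹ = σ₁ n := by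
  let j : H →L[ℂ] K := J.toContinuousLinearMap
  let V : H →L[ℂ] H := ContinuousLinearMap.adjoint j ∘L (U : K →L[ℂ] K) ∘L j
  have hη0 : 0 ≤ η := (norm_nonneg _).trans hUη
  have hVη : ‖1 - V‖ ≤ η := by
    refine ContinuousLinearMap.opNorm_le_bound _ hη0 fun v => ?_
    have h1 : (1 - V) v = ContinuousLinearMap.adjoint j ((1 - (U : K →L[ℂ] K)) (j v)) := by
      have h2 : ContinuousLinearMap.adjoint j (j v) = v :=
        ext_inner_right ℂ fun w => by
          rw [ContinuousLinearMap.adjoint_inner_left]; exact J.inner_map_map v w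
      simp [V, h2]
    rw [h1]
    refine (ContinuousLinearMap.le_opNorm _ _).trans ?_
    have h3 : ‖ContinuousLinearMap.adjoint j‖ ≤ 1 := by
      rw [LinearIsometryEquiv.norm_map]; exact J.norm_toContinuousLinearMap_le
    have h4 : ‖(1 - (U : K →L[ℂ] K)) (j v)‖ ≤ η * ‖v‖ := by
      refine (ContinuousLinearMap.le_opNorm _ _).trans ?_
      have : ‖j v‖ = ‖v‖ := J.norm_map v
      rw [this]
      gcongr
    calc _ ≤ 1 * (η * ‖v‖) := by gcongr
      _ = _ := one_mul _
  have hVσ : ∀ n, V * (σ n : H →L[ℂ] H) = (σ₁ n : H →L[ℂ] H) * V := by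
    intro n
    -- The compression `V = J* U J` intertwines by the same limit argument: `⟨U ρ J v, ρ₁ J w⟩ = ⟨ρ₁
    -- U J v, ρ₁ J w⟩` is constant along `S n k`.
    have h1 : ContinuousLinearMap.adjoint (σ₁ n : H →L[ℂ] H) ∘L V ∘L (σ n : H →L[ℂ] H) = V := by
      refine ContinuousLinearMap.ext fun v => ext_inner_right ℂ fun w => ?_
      simp only [V,
        ContinuousLinearMap.comp_apply, ContinuousLinearMap.adjoint_inner_left]
      have h2 : Filter.Tendsto (fun k => inner ℂ
          ((U : K →L[ℂ] K) ((ρ (S n k) : K →L[ℂ] K) (j v))) ((ρ₁ (S n k) : K →L[ℂ] K) (j w)))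
          Filter.atTop (nhds (inner ℂ ((U : K →L[ℂ] K) (j ((σ n : H →L[ℂ] H) v)))
            (j ((σ₁ n : H →L[ℂ] H) w)))) :=
        (((U : K →L[ℂ] K).continuous.tendsto _).comp (hJ n v)).inner (hJ₁ n w)
      refine tendsto_nhds_unique h2 (tendsto_const_nhds.congr fun k => ?_)
      have h3 : (U : K →L[ℂ] K) ((ρ (S n k) : K →L[ℂ] K) (j v)) =
          (ρ₁ (S n k) : K →L[ℂ] K) ((U : K →L[ℂ] K) (j v)) := by
        have := mul_inv_eq_iff_eq_mul.1 (hU (S n k))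
        exact congrArg (fun T : unitary (K →L[ℂ] K) => (T : K →L[ℂ] K) (j v)) this
      rw [h3]
      exact (ContinuousLinearMap.inner_map_map_of_mem_unitary (ρ₁ (S n k)).2 _ _).symm
    calc V * (σ n : H →L[ℂ] H)
        = (σ₁ n : H →L[ℂ] H) * (star (σ₁ n : H →L[ℂ] H) * (V * (σ n : H →L[ℂ] H))) := by
          rw [← mul_assoc, Unitary.mul_star_self_of_mem (σ₁ n).2, one_mul]
      _ = _ := congrArg _ h1
  obtain ⟨W, hW, hWc⟩ := exists_unitary_near_of_norm_one_sub_lt V (hVη.trans_lt hη)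
  refine ⟨W, hW.trans (by linarith), fun n => ?_⟩
  rw [mul_inv_eq_iff_eq_mul]
  refine Subtype.ext (hWc _ _ (hVσ n) ?_)
  -- For unitary representations, the relation at `n⁻¹` is the one between adjoints.
  have := hVσ n⁻¹
  rwa [map_inv, map_inv] at this

end Transfer

/-! ## Operators and representations twisted by a measurable cocycle -/

section Twist

variable {Y : Type*} [MeasurableSpace Y] {ν : Measure Y} {N : Type*} [Countable N]
variable {H : Type*} [NormedAddCommGroup H] [InnerProductSpace ℂ H]

/-- The operator norm topology need not be separable, but `y ↦ a (d y)` takes only countably many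
values. -/
theorem aestronglyMeasurable_apply_of_countable {d : Y → N} (hd : ∀ n, MeasurableSet (d ⁻¹' {n}))
    (a : N → H →L[ℂ] H) {f : Y → H} (hf : AEStronglyMeasurable f ν) :
    AEStronglyMeasurable (fun y => a (d y) (f y)) ν := by
  let _ : MeasurableSpace N := ⊤
  have h1 : StronglyMeasurable a := .of_discrete
  have h2 : StronglyMeasurable fun y => a (d y) :=
    h1.comp_measurable (measurable_to_countable' hd)
  exact (ContinuousLinearMap.id ℂ (H →L[ℂ] H)).aestronglyMeasurable_comp₂
    h2.aestronglyMeasurable hf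

theorem memLp_twist {d : Y → N} (hd : ∀ n, MeasurableSet (d ⁻¹' {n})) {S : Y → Y}
    (hS : MeasurePreserving S ν ν) {a : N → H →L[ℂ] H} {C : ℝ} (ha : ∀ n, ‖a n‖ ≤ C)
    (F : Lp H 2 ν) : MemLp (fun y => a (d y) (F (S y))) 2 ν := by
  have hF : MemLp (fun y => F (S y)) 2 ν := (Lp.memLp F).comp_measurePreserving hS
  refine hF.of_le_mul (c := C) (aestronglyMeasurable_apply_of_countable hd a hF.1) ?_
  exact .of_forall fun y => (a (d y)).le_of_opNorm_le (ha _) _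

/-- The operator `F ↦ (y ↦ a (d y) (F (S y)))` on `L²(ν, H)`. -/
noncomputable def twistOp {d : Y → N} (hd : ∀ n, MeasurableSet (d ⁻¹' {n})) {S : Y → Y}
    (hS : MeasurePreserving S ν ν) {a : N → H →L[ℂ] H} {C : ℝ} (ha : ∀ n, ‖a n‖ ≤ C) :
    Lp H 2 ν →L[ℂ] Lp H 2 ν :=
  LinearMap.mkContinuous
    { toFun := fun F => (memLp_twist hd hS ha F).toLp _
      map_add' := fun F F' => by
        rw [← MemLp.toLp_add]
        refine MemLp.toLp_congr _ _ ?_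
        filter_upwards [hS.quasiMeasurePreserving.ae_eq_comp (Lp.coeFn_add F F')] with y hy
        simp only [Function.comp_apply, Pi.add_apply] at hy ⊢
        rw [hy, map_add]
      map_smul' := fun c F => by
        rw [RingHom.id_apply, ← MemLp.toLp_const_smul]
        refine MemLp.toLp_congr _ _ ?_
        filter_upwards [hS.quasiMeasurePreserving.ae_eq_comp (Lp.coeFn_smul c F)] with y hy
        simp only [Function.comp_apply, Pi.smul_apply] at hy ⊢
        rw [hy, map_smul] }
    C fun F => by
      rw [← Lp.norm_compMeasurePreserving F hS]
      refine Lp.norm_le_mul_norm_of_ae_le_mul ?_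
      filter_upwards [MemLp.coeFn_toLp (memLp_twist hd hS ha F),
        Lp.coeFn_compMeasurePreserving F hS] with y h1 h2
      simp only [LinearMap.coe_mk, AddHom.coe_mk]
      rw [h1, h2]
      exact (a (d y)).le_of_opNorm_le (ha _) _

variable {d : Y → N} (hd : ∀ n, MeasurableSet (d ⁻¹' {n})) {S : Y → Y}
  (hS : MeasurePreserving S ν ν) {a : N → H →L[ℂ] H} {C : ℝ} (ha : ∀ n, ‖a n‖ ≤ C)

theorem twistOp_coeFn (F : Lp H 2 ν) :
    twistOp hd hS ha F =ᵐ[ν] fun y => a (d y) (F (S y)) :=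
  MemLp.coeFn_toLp (memLp_twist hd hS ha F)

theorem norm_twistOp_le (hC : 0 ≤ C) : ‖twistOp hd hS ha‖ ≤ C :=
  LinearMap.mkContinuous_norm_le _ hC _

theorem norm_twistOp_sub_le {a' : N → H →L[ℂ] H} {C' : ℝ} (ha' : ∀ n, ‖a' n‖ ≤ C')
    {D : ℝ} (hD : 0 ≤ D) (haa' : ∀ n, ‖a n - a' n‖ ≤ D) :
    ‖twistOp hd hS ha - twistOp hd hS ha'‖ ≤ D := by
  refine ContinuousLinearMap.opNorm_le_bound _ hD fun F => ?_
  rw [← Lp.norm_compMeasurePreserving F hS, sub_apply]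
  refine Lp.norm_le_mul_norm_of_ae_le_mul ?_
  filter_upwards [twistOp_coeFn hd hS ha F, twistOp_coeFn hd hS ha' F,
    Lp.coeFn_compMeasurePreserving F hS, Lp.coeFn_sub (twistOp hd hS ha F)
      (twistOp hd hS ha' F)] with y h1 h2 h3 h4
  rw [h4, Pi.sub_apply, h1, h2, h3]
  exact (a (d y) - a' (d y)).le_of_opNorm_le (haa' _) _

end Twist

/-- A measure preserving action of `Γ` on `(Y, ν)` with a measurable cocycle `(g, y) ↦ α g y` into
`N`. The cocycle is written as a function of the endpoint `y` of the arrow `g⁻¹ • y → y`. -/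
structure PMPCocycle (Γ N : Type*) {Y : Type*} [Group Γ] [Group N] [MulAction Γ Y]
    [MeasurableSpace Y] (ν : Measure Y) where
  toFun : Γ → Y → N
  measurePreserving : ∀ g : Γ, MeasurePreserving (fun y : Y => g • y) ν ν
  measurableSet_fiber : ∀ g n, MeasurableSet (toFun g ⁻¹' {n})
  map_mul : ∀ g h y, toFun (g * h) y = toFun g y * toFun h (g⁻¹ • y)

namespace PMPCocycle

section

variable {Γ N Y : Type*} [Group Γ] [Group N] [MulAction Γ Y]
  [MeasurableSpace Y] {ν : Measure Y} (α : PMPCocycle Γ N ν)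
variable {H : Type*} [NormedAddCommGroup H] [InnerProductSpace ℂ H]

theorem map_one (y : Y) : α.toFun 1 y = 1 := by
  have := α.map_mul 1 1 y
  rw [inv_one, one_smul, one_mul] at this
  exact left_eq_mul.1 this

/-- The points of `Y₀` that `g` moves inside `Y₀` along an arrow of cocycle value `n`. -/
def stepSet (Y₀ : Set Y) (g : Γ) (n : N) : Set Y :=
  {y | y ∈ Y₀ ∧ g • y ∈ Y₀ ∧ α.toFun g (g • y) = n}

theorem measurableSet_stepSet {Y₀ : Set Y} (h₀ : MeasurableSet Y₀) (g : Γ) (n : N) :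
    MeasurableSet (α.stepSet Y₀ g n) :=
  h₀.inter (((α.measurePreserving g).measurable h₀).inter
    ((α.measurePreserving g).measurable (α.measurableSet_fiber g n)))

/-- The isometric embedding of `H` in `L²(ν, H)` as the functions constant on a set `Y₀` of measure
`1` and zero elsewhere. -/
noncomputable def embedConst {Y₀ : Set Y} (h₀ : MeasurableSet Y₀) (hν₀ : ν Y₀ = 1) :
    H →ₗᵢ[ℂ] Lp H 2 ν where
  toFun v := indicatorConstLp 2 h₀ (by simp [hν₀]) v
  map_add' v v' := indicatorConstLp_add.symm
  map_smul' c v := by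
    rw [RingHom.id_apply, indicatorConstLp, indicatorConstLp, ← MemLp.toLp_const_smul]
    congr 1
    ext y
    by_cases hy : y ∈ Y₀ <;> simp [hy]
  norm_map' v := by
    change ‖indicatorConstLp 2 h₀ (by simp [hν₀] : ν Y₀ ≠ ⊤) v‖ = _
    rw [norm_indicatorConstLp (by simp) (by simp)]
    simp [measureReal_def, hν₀]

variable [Countable N]

/-- The representation of `Γ` on `L²(ν, H)` induced through the cocycle `α` from a uniformly bounded
representation `π` of `N` on `H`. -/
noncomputable def inducedRep (π : N →* (H →L[ℂ] H)) {C : ℝ} (hπ : ∀ n, ‖π n‖ ≤ C) :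
    Γ →* (Lp H 2 ν →L[ℂ] Lp H 2 ν) where
  toFun g := twistOp (α.measurableSet_fiber g) (α.measurePreserving g⁻¹) hπ
  map_one' := by
    refine ContinuousLinearMap.ext fun F => Lp.ext ?_
    filter_upwards [twistOp_coeFn (α.measurableSet_fiber 1) (α.measurePreserving 1⁻¹) hπ F]
      with y hy
    rw [hy, α.map_one, inv_one, one_smul, _root_.map_one]
    rfl
  map_mul' g h := by
    refine ContinuousLinearMap.ext fun F => Lp.ext ?_
    change _ =ᵐ[ν] twistOp (α.measurableSet_fiber g) (α.measurePreserving g⁻¹) hπ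
      (twistOp (α.measurableSet_fiber h) (α.measurePreserving h⁻¹) hπ F)
    filter_upwards [twistOp_coeFn (α.measurableSet_fiber (g * h))
        (α.measurePreserving (g * h)⁻¹) hπ F,
      twistOp_coeFn (α.measurableSet_fiber g) (α.measurePreserving g⁻¹) hπ
        (twistOp (α.measurableSet_fiber h) (α.measurePreserving h⁻¹) hπ F),
      (α.measurePreserving g⁻¹).quasiMeasurePreserving.ae_eq_comp
        (twistOp_coeFn (α.measurableSet_fiber h) (α.measurePreserving h⁻¹) hπ F)] with y h1 h2 h3
    simp only [Function.comp_apply] at h3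
    rw [h1, h2, h3, α.map_mul, _root_.map_mul, mul_inv_rev, mul_smul]
    rfl

variable {π : N →* (H →L[ℂ] H)} {C : ℝ} (hπ : ∀ n, ‖π n‖ ≤ C)

theorem inducedRep_coeFn (g : Γ) (F : Lp H 2 ν) :
    α.inducedRep π hπ g F =ᵐ[ν] fun y => π (α.toFun g y) (F (g⁻¹ • y)) :=
  twistOp_coeFn (α.measurableSet_fiber g) (α.measurePreserving g⁻¹) hπ F

theorem norm_inducedRep_le (g : Γ) : ‖α.inducedRep π hπ g‖ ≤ C :=
  norm_twistOp_le (α.measurableSet_fiber g) (α.measurePreserving g⁻¹) hπ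
    ((norm_nonneg _).trans (hπ 1))

theorem norm_inducedRep_sub_le {π' : N →* (H →L[ℂ] H)} {C' : ℝ} (hπ' : ∀ n, ‖π' n‖ ≤ C')
    {D : ℝ} (hD : ∀ n, ‖π n - π' n‖ ≤ D) (g : Γ) :
    ‖α.inducedRep π hπ g - α.inducedRep π' hπ' g‖ ≤ D :=
  norm_twistOp_sub_le (α.measurableSet_fiber g) (α.measurePreserving g⁻¹) hπ hπ'
    ((norm_nonneg _).trans (hD 1)) hD

theorem inducedRep_indicatorConstLp {A : Set Y} (hA : MeasurableSet A) (hνA : ν A ≠ ⊤) (g : Γ)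
    (n : N) (hgA : ∀ y ∈ A, α.toFun g (g • y) = n) (v : H) :
    α.inducedRep π hπ g (indicatorConstLp 2 hA hνA v) =
      indicatorConstLp 2 ((α.measurePreserving g⁻¹).measurable hA)
        (by rwa [(α.measurePreserving g⁻¹).measure_preimage hA.nullMeasurableSet]) (π n v) := by
  refine Lp.ext ?_
  filter_upwards [α.inducedRep_coeFn hπ g (indicatorConstLp 2 hA hνA v),
    (α.measurePreserving g⁻¹).quasiMeasurePreserving.ae_eq_comp
      (indicatorConstLp_coeFn (p := 2) (hs := hA) (hμs := hνA) (c := v)),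
    indicatorConstLp_coeFn (p := 2) (hs := (α.measurePreserving g⁻¹).measurable hA)
      (hμs := by rwa [(α.measurePreserving g⁻¹).measure_preimage hA.nullMeasurableSet])
      (c := π n v)] with y h1 h2 h3
  simp only [Function.comp_apply] at h2
  rw [h1, h2, h3]
  by_cases hy : g⁻¹ • y ∈ A
  · have := hgA _ hy
    rw [smul_inv_smul] at this
    rw [Set.indicator_of_mem hy, this, Set.indicator_of_mem (by exact hy)]
  · rw [Set.indicator_of_notMem hy, Set.indicator_of_notMem (by exact hy), map_zero]

/-- Let `A ⊆ Y₀` be the step set and `B = g • A ⊆ Y₀`. The part of the constant function on `A` is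
sent exactly to the constant `π n v` on `B`. What remains lives on `Y₀ \ A` and `Y₀ \ B`, which have
equal measure, and each contributes at most `C ‖v‖` times the root of that measure. -/
theorem norm_inducedRep_indicatorConstLp_sub_le {Y₀ : Set Y} (h₀ : MeasurableSet Y₀)
    (hν₀ : ν Y₀ ≠ ⊤) (g : Γ) (n : N) (v : H) :
    ‖α.inducedRep π hπ g (indicatorConstLp 2 h₀ hν₀ v) - indicatorConstLp 2 h₀ hν₀ (π n v)‖ ≤
      2 * C * ‖v‖ * ν.real (Y₀ \ α.stepSet Y₀ g n) ^ (1 / 2 : ℝ) := by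
  have hC : 0 ≤ C := (norm_nonneg _).trans (hπ 1)
  set A := α.stepSet Y₀ g n with hAdef
  have hAm : MeasurableSet A := α.measurableSet_stepSet h₀ g n
  have hAsub : A ⊆ Y₀ := fun y hy => hy.1
  have hνA : ν A ≠ ⊤ := ne_top_of_le_ne_top hν₀ (measure_mono hAsub)
  have hνD : ν (Y₀ \ A) ≠ ⊤ := ne_top_of_le_ne_top hν₀ (measure_mono Set.sdiff_subset)
  set B := (fun y => g⁻¹ • y) ⁻¹' A with hBdef
  have hBm : MeasurableSet B := (α.measurePreserving g⁻¹).measurable hAm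
  have hνB' : ν B = ν A := (α.measurePreserving g⁻¹).measure_preimage hAm.nullMeasurableSet
  have hBsub : B ⊆ Y₀ := fun y hy => by
    have := hy.2.1
    simpa using this
  have hνB : ν B ≠ ⊤ := hνB' ▸ hνA
  have hνE : ν (Y₀ \ B) ≠ ⊤ := ne_top_of_le_ne_top hν₀ (measure_mono Set.sdiff_subset)
  have hreal : ν.real (Y₀ \ B) = ν.real (Y₀ \ A) := by
    rw [measureReal_def, measureReal_def, measure_sdiff hBsub hBm.nullMeasurableSet hνB,
      measure_sdiff hAsub hAm.nullMeasurableSet hνA, hνB']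
  have split (A : Set Y) (hA : MeasurableSet A) (hνA : ν A ≠ ⊤) (hνD : ν (Y₀ \ A) ≠ ⊤)
      (hsub : A ⊆ Y₀) (v : H) : indicatorConstLp 2 h₀ hν₀ v =
        indicatorConstLp 2 hA hνA v + indicatorConstLp 2 (h₀.diff hA) hνD v := by
    rw [← indicatorConstLp_disjoint_union hA (h₀.diff hA) hνA hνD Set.disjoint_sdiff_right]
    congr 1
    exact (Set.union_sdiff_cancel hsub).symm
  rw [split A hAm hνA hνD hAsub v, split B hBm hνB hνE hBsub (π n v), map_add,
    α.inducedRep_indicatorConstLp hπ hAm hνA g n (fun y hy => hy.2.2) v, add_sub_add_left_eq_sub]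
  refine (norm_sub_le _ _).trans ?_
  have h1 : ‖α.inducedRep π hπ g (indicatorConstLp 2 (h₀.diff hAm) hνD v)‖ ≤
      C * (‖v‖ * ν.real (Y₀ \ A) ^ (1 / 2 : ℝ)) := by
    refine (ContinuousLinearMap.le_of_opNorm_le _ (α.norm_inducedRep_le hπ g) _).trans_eq ?_
    rw [norm_indicatorConstLp (by simp) (by simp)]
    simp
  have h2 : ‖indicatorConstLp 2 (h₀.diff hBm) hνE (π n v)‖ ≤
      C * ‖v‖ * ν.real (Y₀ \ A) ^ (1 / 2 : ℝ) := by
    rw [norm_indicatorConstLp (by simp) (by simp), hreal]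
    simp only [ENNReal.toReal_ofNat]
    gcongr
    exact (π n).le_of_opNorm_le (hπ n) v
  linarith

theorem approxBy_inducedRep {Y₀ : Set Y} (h₀ : MeasurableSet Y₀) (hν₀ : ν Y₀ = 1)
    {S : N → ℕ → Γ} (hS : ∀ n, Filter.Tendsto (fun k => ν.real (Y₀ \ α.stepSet Y₀ (S n k) n))
      Filter.atTop (nhds 0)) :
    ApproxBy S π (α.inducedRep π hπ) (embedConst (H := H) h₀ hν₀).toContinuousLinearMap := by
  intro n v
  rw [tendsto_iff_norm_sub_tendsto_zero]
  refine squeeze_zero (fun _ => norm_nonneg _)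
    (fun k => α.norm_inducedRep_indicatorConstLp_sub_le hπ h₀ (by simp [hν₀]) (S n k) n v) ?_
  have := ((hS n).rpow_const (p := 1 / 2) (Or.inr (by norm_num))).const_mul (2 * C * ‖v‖)
  simpa using this

end

end PMPCocycle

/-! ## Induction of uniformly bounded and of unitary representations -/

section

variable {Γ : Type*} [Group Γ] {H : Type*} [NormedAddCommGroup H] [InnerProductSpace ℂ H]
  [CompleteSpace H]

/-- An invertible contraction whose inverse is also a contraction is isometric. -/
theorem mem_unitary_of_norm_le_one (ρ : Γ →* (H →L[ℂ] H)) (hρ : ∀ g, ‖ρ g‖ ≤ 1) (g : Γ) :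
    ρ g ∈ unitary (H →L[ℂ] H) := by
  have hle (g : Γ) (v : H) : ‖ρ g v‖ ≤ ‖v‖ := by
    simpa using (ρ g).le_of_opNorm_le (hρ g) v
  have hinv (g : Γ) (v : H) : ρ g⁻¹ (ρ g v) = v := by
    have : ρ g⁻¹ * ρ g = 1 := by rw [← map_mul, inv_mul_cancel, map_one]
    exact congrArg (fun T : H →L[ℂ] H => T v) this
  have hnorm (v : H) : ‖ρ g v‖ = ‖v‖ := by
    refine le_antisymm (hle g v) ?_
    conv_lhs => rw [← hinv g v]
    exact hle _ _
  have hu : IsUnit (ρ g) := ((MonoidHom.toHomUnits ρ) g).isUnit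
  refine hu.mem_unitary_of_star_mul_self ?_
  exact (ContinuousLinearMap.norm_map_iff_adjoint_comp_self _).1 hnorm

/-- A representation by contractions, as a unitary representation. -/
noncomputable def unitaryOfNormLeOne (ρ : Γ →* (H →L[ℂ] H)) (hρ : ∀ g, ‖ρ g‖ ≤ 1) :
    Γ →* unitary (H →L[ℂ] H) :=
  ρ.codRestrict (unitary (H →L[ℂ] H)) (mem_unitary_of_norm_le_one ρ hρ)

theorem norm_coe_unitary_le_one (U : unitary (H →L[ℂ] H)) : ‖(U : H →L[ℂ] H)‖ ≤ 1 :=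
  ContinuousLinearMap.opNorm_le_bound _ zero_le_one fun v => by
    rw [ContinuousLinearMap.norm_map_of_mem_unitary U.2, one_mul]

theorem norm_sub_le_unitaryRepDist (ρ ρ₁ : Γ →* unitary (H →L[ℂ] H)) (g : Γ) :
    ‖(ρ g : H →L[ℂ] H) - (ρ₁ g : H →L[ℂ] H)‖ ≤ unitaryRepDist ρ ρ₁ := by
  refine le_ciSup (f := fun g => ‖(ρ g : H →L[ℂ] H) - (ρ₁ g : H →L[ℂ] H)‖) ⟨2, ?_⟩ g
  rintro _ ⟨g, rfl⟩
  refine (norm_sub_le _ _).trans ?_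
  linarith [norm_coe_unitary_le_one (ρ g), norm_coe_unitary_le_one (ρ₁ g)]

end

namespace PMPCocycle

variable {Γ : Type*} [Group Γ] {N : Type w} [Group N] [Countable N] {Y : Type u} [MulAction Γ Y]
  [MeasurableSpace Y] {ν : Measure Y} (α : PMPCocycle Γ N ν)
  {G : Type*} [Group G] (j : G →* Γ) {Y₀ : Set Y}

theorem unitarizableGroup_of_tendsto
    (h₀ : MeasurableSet Y₀) (hν₀ : ν Y₀ = 1) {S : N → ℕ → G} (hS : ∀ n, Filter.Tendsto
      (fun k => ν.real (Y₀ \ α.stepSet Y₀ (j (S n k)) n)) Filter.atTop (nhds 0))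
    (hG : UnitarizableGroup.{max u v} G) :
    UnitarizableGroup.{max u v} N := by
  intro H _ _ _ π ⟨C, hC⟩
  let π' : N →* (H →L[ℂ] H) := (Units.coeHom _).comp π
  have hπ' : ∀ n, ‖π' n‖ ≤ C := fun n => (hC n).le
  let ρ : G →* (Lp H 2 ν →L[ℂ] Lp H 2 ν) := (α.inducedRep π' hπ').comp j
  have happ : ApproxBy S (fun n => (π n : H →L[ℂ] H))
      (fun g => (ρ.toHomUnits g : Lp H 2 ν →L[ℂ] Lp H 2 ν))
      (embedConst (H := H) h₀ hν₀).toContinuousLinearMap :=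
    α.approxBy_inducedRep hπ' h₀ hν₀ (S := fun n k => j (S n k)) hS
  have hρb : UniformlyBoundedRep ρ.toHomUnits :=
    ⟨C + 1, fun g => (α.norm_inducedRep_le hπ' (j g)).trans_lt (lt_add_one C)⟩
  have hρ : UnitarizableRep ρ.toHomUnits := hG (Lp H 2 ν) ρ.toHomUnits hρb
  exact UnitarizableRep.of_approxBy happ hρ

theorem hasNotStronglyRigidRep_of_tendsto
    (h₀ : MeasurableSet Y₀) (hν₀ : ν Y₀ = 1) {S : N → ℕ → G} (hS : ∀ n, Filter.Tendsto
      (fun k => ν.real (Y₀ \ α.stepSet Y₀ (j (S n k)) n)) Filter.atTop (nhds 0))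
    (hN : HasNotStronglyRigidRep.{max u v} N) :
    HasNotStronglyRigidRep.{max u v} G := by
  obtain ⟨H, _, _, _, σ, hσ⟩ := hN
  have hbd (τ : N →* unitary (H →L[ℂ] H)) (n : N) :
      ‖((unitary (H →L[ℂ] H)).subtype.comp τ) n‖ ≤ 1 := norm_coe_unitary_le_one (τ n)
  let ind (τ : N →* unitary (H →L[ℂ] H)) : G →* unitary (Lp H 2 ν →L[ℂ] Lp H 2 ν) :=
    unitaryOfNormLeOne ((α.inducedRep _ (hbd τ)).comp j)
      fun g => α.norm_inducedRep_le (hbd τ) (j g)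
  have happ (τ : N →* unitary (H →L[ℂ] H)) :
      ApproxBy S (fun n => (τ n : H →L[ℂ] H)) (fun g => (ind τ g : Lp H 2 ν →L[ℂ] Lp H 2 ν))
        (embedConst (H := H) h₀ hν₀).toContinuousLinearMap :=
    α.approxBy_inducedRep (hbd τ) h₀ hν₀ (S := fun n k => j (S n k)) hS
  refine ⟨Lp H 2 ν, inferInstance, inferInstance, inferInstance, ind σ, fun hrigid => hσ ?_⟩
  intro ε hε
  -- The bound `1 / 2` keeps the compression invertible; `ε / 8` absorbs the factor `4` lost to the
  -- polar part and leaves `ε / 2 < ε`.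
  obtain ⟨δ, hδ, h⟩ := hrigid (min (1 / 2) (ε / 8)) (by positivity)
  refine ⟨δ, hδ, fun σ₁ hσ₁ => ?_⟩
  -- Induction does not increase the uniform distance, since the induced operators differ pointwise
  -- by some `σ n - σ₁ n`.
  have hdist : unitaryRepDist (ind σ) (ind σ₁) < δ := by
    refine lt_of_le_of_lt (ciSup_le fun g => ?_) hσ₁
    exact α.norm_inducedRep_sub_le (hbd σ) (hbd σ₁)
      (fun n => norm_sub_le_unitaryRepDist σ σ₁ n) (j g)
  obtain ⟨U, hU, hUc⟩ := h (ind σ₁) hdist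
  obtain ⟨W, hW, hWc⟩ := exists_unitary_conj_of_approxBy (happ σ) (happ σ₁) U hUc
    (η := min (1 / 2) (ε / 8)) (lt_of_le_of_lt (min_le_left _ _) (by norm_num)) hU.le
  refine ⟨W, lt_of_le_of_lt hW ?_, hWc⟩
  have := min_le_right (1 / 2 : ℝ) (ε / 8)
  linarith

end PMPCocycle

/-! ## The coset space of a free subaction -/

section CosetSpace

/-- An enumeration of a countable group, starting at the identity. -/
noncomputable def groupEnum (Γ : Type*) [Group Γ] [Countable Γ] : ℕ → Γ
  -- This value makes `x` itself the representative of `N • x` over `x`, so that the base piece is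
  -- the set of index `0`.
  | 0 => 1
  | i + 1 => (exists_surjective_nat Γ).choose i

theorem groupEnum_surjective (Γ : Type*) [Group Γ] [Countable Γ] :
    Function.Surjective (groupEnum Γ) := fun γ =>
  let ⟨i, hi⟩ := (exists_surjective_nat Γ).choose_spec γ
  ⟨i + 1, hi⟩

variable {X : Type u} {Γ : Type*} [Group Γ] [MulAction Γ X] {N : Type w} [Group N] (ι : N →* Γ)

/-- The points on whose `Γ`-orbit `N` acts freely. -/
def freeOrbitSet (X : Type u) [MulAction Γ X] : Set X :=
  {x | ∀ (γ : Γ) (n : N), ι n • γ • x = γ • x → n = 1}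

variable {ι} in
theorem smul_mem_freeOrbitSet {x : X} (hx : x ∈ freeOrbitSet ι X) (g : Γ) :
    g • x ∈ freeOrbitSet ι X := fun γ n h => by
  rw [← mul_smul γ g] at h
  exact hx _ _ h

variable [Countable Γ]

/-- The pairs `(x, i)` such that `i` is the first index of the `N`-orbit of `γᵢ • x`, where `(γᵢ)`
enumerates `Γ`. -/
def cosetSet (X : Type u) [MulAction Γ X] : Set (X × ℕ) :=
  {q | q.1 ∈ freeOrbitSet ι X ∧
    ∀ i < q.2, ∀ n : N, ι n • groupEnum Γ i • q.1 ≠ groupEnum Γ q.2 • q.1}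

/-- The space of pairs of a point `x` and an `N`-orbit contained in the `Γ`-orbit of `x`, the
`N`-orbit being given by its first index. -/
def CosetSpace (X : Type u) [MulAction Γ X] : Type u := cosetSet ι X

namespace CosetSpace

variable {ι}

/-- The first component of a point of the coset space. -/
def fst (y : CosetSpace ι X) : X := y.1.1

/-- The index of the `N`-orbit of a point of the coset space. -/
def idx (y : CosetSpace ι X) : ℕ := y.1.2

/-- The representative of the `N`-orbit of a point of the coset space. -/
noncomputable def rep (y : CosetSpace ι X) : X := groupEnum Γ y.idx • y.fst

theorem fst_mem (y : CosetSpace ι X) : y.fst ∈ freeOrbitSet ι X := y.2.1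

theorem ext_of_fst_idx {y y' : CosetSpace ι X} (h : y.fst = y'.fst) (h' : y.idx = y'.idx) :
    y = y' := Subtype.ext (Prod.ext h h')

theorem eq_of_smul_rep (y : CosetSpace ι X) {n m : N} (h : ι n • y.rep = ι m • y.rep) : n = m := by
  have : ι (m⁻¹ * n) • y.rep = y.rep := by
    rw [map_mul, mul_smul, h, ← mul_smul, ← map_mul, inv_mul_cancel, map_one, one_smul]
  have := y.fst_mem _ _ this
  rwa [inv_mul_eq_one, eq_comm] at this

/-- Two different indices of one `N`-orbit over the same point cannot both be the first. -/
theorem ext_of_smul_rep {y y' : CosetSpace ι X} (h : y.fst = y'.fst) {n : N}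
    (hn : ι n • y.rep = y'.rep) : y = y' := by
  refine ext_of_fst_idx h ?_
  rcases lt_trichotomy y.idx y'.idx with hlt | heq | hlt
  · refine absurd hn ?_
    have := y'.2.2 _ hlt n
    rw [rep, h]
    exact this
  · exact heq
  · have hn' : ι n⁻¹ • y'.rep = y.rep := by
      rw [← hn, ← mul_smul, ← map_mul, inv_mul_cancel, map_one, one_smul]
    refine absurd hn' ?_
    have := y.2.2 _ hlt n⁻¹
    rw [rep, ← h]
    exact this

theorem exists_rep {x : X} (hx : x ∈ freeOrbitSet ι X) (γ : Γ) :
    ∃ y : CosetSpace ι X, y.fst = x ∧ ∃ n : N, ι n • y.rep = γ • x := by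
  classical
  have hex : ∃ i, ∃ n : N, ι n • groupEnum Γ i • x = γ • x := by
    obtain ⟨i, rfl⟩ := groupEnum_surjective Γ γ
    exact ⟨i, 1, by rw [map_one, one_smul]⟩
  obtain ⟨n, hn⟩ := Nat.find_spec hex
  refine ⟨⟨(x, Nat.find hex), hx, fun i hi m hm => Nat.find_min hex hi ⟨n * m, ?_⟩⟩, rfl, n, hn⟩
  rw [map_mul, mul_smul, hm]
  exact hn

/-- The orbit of `γ • x` is also that of `(γ * g⁻¹) • (g • x)`, so it lies over `g • x` as well,
though its first index and representative may change. The change of representative is what the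
cocycle records. -/
theorem exists_smul (g : Γ) (y : CosetSpace ι X) :
    ∃ y' : CosetSpace ι X, y'.fst = g • y.fst ∧ ∃ n : N, ι n • y'.rep = y.rep := by
  obtain ⟨y', h, n, hn⟩ := exists_rep (smul_mem_freeOrbitSet y.fst_mem g) (groupEnum Γ y.idx * g⁻¹)
  refine ⟨y', h, n, hn.trans ?_⟩
  rw [mul_smul, inv_smul_smul]
  rfl

noncomputable instance : SMul Γ (CosetSpace ι X) where
  smul g y := (exists_smul g y).choose

@[simp]
theorem fst_smul (g : Γ) (y : CosetSpace ι X) : (g • y).fst = g • y.fst :=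
  (exists_smul g y).choose_spec.1

theorem exists_smul_rep_smul (g : Γ) (y : CosetSpace ι X) :
    ∃ n : N, ι n • (g • y).rep = y.rep :=
  (exists_smul g y).choose_spec.2

/-- A point is determined by its first component and its `N`-orbit, so the action axioms reduce to
exhibiting one element of `N` between representatives. -/
theorem smul_eq_of {g : Γ} {y y' : CosetSpace ι X} (h : y'.fst = g • y.fst) {n : N}
    (hn : ι n • y'.rep = y.rep) : g • y = y' := by
  obtain ⟨m, hm⟩ := exists_smul_rep_smul g y
  refine (ext_of_smul_rep (n := m⁻¹ * n) (by rw [h, fst_smul]) ?_).symm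
  rw [map_mul, mul_smul, hn, ← hm, ← mul_smul, ← map_mul, inv_mul_cancel, map_one, one_smul]

noncomputable instance : MulAction Γ (CosetSpace ι X) where
  one_smul y := smul_eq_of (n := 1) (one_smul _ _).symm (by rw [map_one, one_smul])
  mul_smul g h y := by
    obtain ⟨n, hn⟩ := exists_smul_rep_smul h y
    obtain ⟨m, hm⟩ := exists_smul_rep_smul g (h • y)
    refine smul_eq_of (n := n * m) (by rw [fst_smul, fst_smul, mul_smul]) ?_
    rw [map_mul, mul_smul, hm, hn]

/-- The element of `N` that takes the representative of `g⁻¹ • y` to the representative of `y`. -/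
noncomputable def cocycle (g : Γ) (y : CosetSpace ι X) : N := (exists_smul_rep_smul g⁻¹ y).choose

theorem cocycle_smul_rep (g : Γ) (y : CosetSpace ι X) :
    ι (cocycle g y) • (g⁻¹ • y).rep = y.rep :=
  (exists_smul_rep_smul g⁻¹ y).choose_spec

theorem cocycle_eq_iff {g : Γ} {y : CosetSpace ι X} {n : N} :
    cocycle g y = n ↔ ι n • (g⁻¹ • y).rep = y.rep := by
  refine ⟨fun h => h ▸ cocycle_smul_rep g y, fun h => ?_⟩
  exact eq_of_smul_rep (g⁻¹ • y) ((cocycle_smul_rep g y).trans h.symm)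

theorem cocycle_mul (g h : Γ) (y : CosetSpace ι X) :
    cocycle (g * h) y = cocycle g y * cocycle h (g⁻¹ • y) := by
  rw [cocycle_eq_iff, map_mul, mul_smul, mul_inv_rev, mul_smul, cocycle_smul_rep, cocycle_smul_rep]

/-- The base piece, the points `(x, N • x)`. -/
def base (ι : N →* Γ) (X : Type u) [MulAction Γ X] : Set (CosetSpace ι X) := {y | y.idx = 0}

theorem rep_of_mem_base {y : CosetSpace ι X} (hy : y ∈ base ι X) : y.rep = y.fst := by
  have : y.idx = 0 := hy
  rw [rep, this, groupEnum, one_smul]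

/-- If `g • x = n • x`, then `N • (g • x) = N • x`, so `(x, N • x)` goes to the base point over `g •
x`; the representatives are `x` and `n • x`. -/
theorem smul_mem_base_of_smul_eq {g : Γ} {n : N} {y : CosetSpace ι X} (hy : y ∈ base ι X)
    (h : g • y.fst = ι n • y.fst) : g • y ∈ base ι X ∧ cocycle g (g • y) = n := by
  let y' : CosetSpace ι X := ⟨(g • y.fst, 0), smul_mem_freeOrbitSet y.fst_mem g,
    fun i hi => absurd hi (Nat.not_lt_zero i)⟩
  have hy' : y' ∈ base ι X := rfl
  have hgy : g • y = y' := by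
    refine smul_eq_of (n := n⁻¹) rfl ?_
    rw [rep_of_mem_base hy, rep_of_mem_base hy']
    change ι n⁻¹ • g • y.fst = y.fst
    rw [h, ← mul_smul, ← map_mul, inv_mul_cancel, map_one, one_smul]
  refine ⟨hgy ▸ hy', ?_⟩
  rw [cocycle_eq_iff, inv_smul_smul, rep_of_mem_base hy, ← h, hgy, rep_of_mem_base hy']
  rfl

/-! ### Measurability and the invariant measure on the coset space -/

section Measure

variable [MeasurableSpace X]

instance : MeasurableSpace (CosetSpace ι X) := inferInstanceAs (MeasurableSpace (cosetSet ι X))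

theorem measurable_fst : Measurable (fst : CosetSpace ι X → X) :=
  _root_.measurable_fst.comp measurable_subtype_coe

theorem measurable_idx : Measurable (idx : CosetSpace ι X → ℕ) :=
  measurable_snd.comp measurable_subtype_coe

theorem measurableSet_base : MeasurableSet (base ι X) :=
  measurable_idx (measurableSet_singleton 0)

/-- The measure on the coset space that integrates the counting measures of the fibers. -/
noncomputable def measure (ι : N →* Γ) (μ : Measure X) : Measure (CosetSpace ι X) :=
  Measure.comap (Subtype.val : cosetSet ι X → X × ℕ) (μ.prod Measure.count)

theorem measurable_rep (hact : ∀ g : Γ, Measurable fun x : X => g • x) :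
    Measurable (rep : CosetSpace ι X → X) :=
  (measurable_from_prod_countable_left fun i => hact (groupEnum Γ i) :
    Measurable fun q : X × ℕ => groupEnum Γ q.2 • q.1).comp measurable_subtype_coe

variable [MeasurableEq X] [Countable N]

theorem measurableSet_freeOrbitSet (hact : ∀ g : Γ, Measurable fun x : X => g • x) :
    MeasurableSet (freeOrbitSet ι X) := by
  simp only [freeOrbitSet, Set.ofPred_forall]
  refine .iInter fun γ => .iInter fun n => ?_
  by_cases hn : n = 1
  · simp [hn]
  · simp only [hn, imp_false]
    exact (measurableSet_eq_fun ((hact _).comp (hact _)) (hact _)).compl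

theorem measurableSet_cosetSet (hact : ∀ g : Γ, Measurable fun x : X => g • x) :
    MeasurableSet (cosetSet ι X) := by
  have hm (k : X × ℕ → ℕ) (hk : Measurable k) :
      Measurable fun q : X × ℕ => groupEnum Γ (k q) • q.1 :=
    (measurable_from_prod_countable_left fun i => hact (groupEnum Γ i) :
      Measurable fun q : X × ℕ => groupEnum Γ q.2 • q.1).comp
      (_root_.measurable_fst.prodMk hk)
  have : cosetSet ι X = Prod.fst ⁻¹' freeOrbitSet ι X ∩ ⋂ i : ℕ, (Prod.snd ⁻¹' (Set.Ioi i))ᶜ ∪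
      ⋂ n : N, {q | ι n • groupEnum Γ i • q.1 = groupEnum Γ q.2 • q.1}ᶜ := by
    ext q
    simp only [cosetSet, Set.mem_ofPred_eq, Set.mem_inter_iff, Set.mem_iInter, Set.mem_union,
      Set.mem_compl_iff, Set.mem_preimage, Set.mem_Ioi, imp_iff_not_or, ne_eq]
  rw [this]
  refine ((measurableSet_freeOrbitSet hact).preimage _root_.measurable_fst).inter
    (.iInter fun i => .union (measurable_snd measurableSet_Ioi).compl (.iInter fun n => ?_))
  exact (measurableSet_eq_fun ((hact _).comp (hm _ measurable_const)) (hm _ measurable_snd)).compl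

theorem measurable_smul (hact : ∀ g : Γ, Measurable fun x : X => g • x) (g : Γ) :
    Measurable fun y : CosetSpace ι X => g • y := by
  have hidx : Measurable fun y : CosetSpace ι X => (g • y).idx := by
    refine measurable_to_countable' fun i => ?_
    -- The chosen point `g • y` is unique, so its index is described by countably many measurable
    -- conditions.
    have : (fun y : CosetSpace ι X => (g • y).idx) ⁻¹' {i} =
        {y | (g • y.fst, i) ∈ cosetSet ι X} ∩
          ⋃ n : N, {y | ι n • groupEnum Γ i • g • y.fst = y.rep} := by
      ext y
      simp only [Set.mem_preimage, Set.mem_singleton_iff, Set.mem_inter_iff, Set.mem_ofPred_eq,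
        Set.mem_iUnion]
      constructor
      · rintro rfl
        obtain ⟨n, hn⟩ := exists_smul_rep_smul g y
        rw [rep, fst_smul] at hn
        refine ⟨?_, n, hn⟩
        have := (g • y).2
        rwa [← fst_smul]
      · rintro ⟨h, n, hn⟩
        have := smul_eq_of (g := g) (y := y) (y' := ⟨(g • y.fst, i), h⟩) rfl hn
        rw [this]
        rfl
    rw [this]
    have hg := (hact g).comp (measurable_fst (ι := ι))
    refine ((measurableSet_cosetSet hact).preimage (hg.prodMk measurable_const)).inter
      (.iUnion fun n => ?_)
    exact measurableSet_eq_fun ((hact _).comp ((hact _).comp hg)) (measurable_rep hact)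
  have hfst : Measurable fun y : CosetSpace ι X => (g • y).fst := by
    simp only [fst_smul]
    exact (hact g).comp measurable_fst
  exact (hfst.prodMk hidx).subtype_mk (h := fun y => (g • y).2)

theorem measurableSet_cocycle (hact : ∀ g : Γ, Measurable fun x : X => g • x) (g : Γ) (n : N) :
    MeasurableSet ((cocycle g : CosetSpace ι X → N) ⁻¹' {n}) := by
  have : (cocycle g : CosetSpace ι X → N) ⁻¹' {n} = {y | ι n • (g⁻¹ • y).rep = y.rep} := by
    ext y
    exact cocycle_eq_iff
  rw [this]
  exact measurableSet_eq_fun ((hact _).comp ((measurable_rep hact).comp (measurable_smul hact _)))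
    (measurable_rep hact)

theorem measure_apply (hact : ∀ g : Γ, Measurable fun x : X => g • x) {μ : Measure X}
    {s : Set (CosetSpace ι X)} (hs : MeasurableSet s) :
    measure ι μ s = ∫⁻ x, ((s ∩ fst ⁻¹' {x}).encard : ENNReal) ∂μ := by
  have hemb := MeasurableEmbedding.subtype_coe (measurableSet_cosetSet (ι := ι) hact)
  have h1 : measure ι μ s = (μ.prod Measure.count) ((Subtype.val : cosetSet ι X → X × ℕ) '' s) :=
    hemb.comap_apply _ s
  rw [h1, Measure.prod_apply (hemb.measurableSet_image.2 hs)]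
  refine lintegral_congr fun x => ?_
  rw [Measure.count_apply (.of_discrete)]
  congr 1
  have : Prod.mk x ⁻¹' ((Subtype.val : cosetSet ι X → X × ℕ) '' s) =
      idx '' (s ∩ fst ⁻¹' {x}) := by
    ext i
    constructor
    · rintro ⟨y, hy, hyi⟩
      exact ⟨y, ⟨hy, congrArg Prod.fst hyi⟩, congrArg Prod.snd hyi⟩
    · rintro ⟨y, ⟨hy, hyx⟩, hyi⟩
      exact ⟨y, hy, Prod.ext hyx hyi⟩
  rw [this]
  refine Set.InjOn.encard_image fun y hy y' hy' h => ?_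
  exact ext_of_fst_idx (hy.2.trans hy'.2.symm) h

/-- The action maps the fiber over `x` bijectively onto the fiber over `g • x`, so invariance
follows by integrating fiber cardinalities against the invariant measure `μ`. -/
theorem measurePreserving_smul {μ : Measure X}
    (hact : ∀ g : Γ, MeasurePreserving (fun x : X => g • x) μ μ) (g : Γ) :
    MeasurePreserving (fun y : CosetSpace ι X => g • y) (measure ι μ) (measure ι μ) := by
  have hm := measurable_smul (ι := ι) (fun g => (hact g).measurable) g
  refine ⟨hm, Measure.ext fun s hs => ?_⟩
  rw [Measure.map_apply hm hs, measure_apply (fun g => (hact g).measurable) (hm hs),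
    measure_apply (fun g => (hact g).measurable) hs]
  have hfib (x : X) : ((fun y : CosetSpace ι X => g • y) ⁻¹' s ∩ fst ⁻¹' {x}).encard =
      (s ∩ fst ⁻¹' {g • x}).encard := by
    rw [← (MulAction.injective g).encard_image]
    congr 1
    ext y
    constructor
    · rintro ⟨z, ⟨hz, hzx⟩, rfl⟩
      refine ⟨hz, ?_⟩
      have : z.fst = x := hzx
      simp [this]
    · rintro ⟨hy, hyx⟩
      have : y.fst = g • x := hyx
      refine ⟨g⁻¹ • y, ⟨?_, ?_⟩, smul_inv_smul g y⟩
      · simpa using hy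
      · simp [this]
  simp only [hfib]
  let e : X ≃ᵐ X := ⟨MulAction.toPerm g, (hact g).measurable, (hact g⁻¹).measurable⟩
  exact (hact g).lintegral_comp_emb e.measurableEmbedding
    fun x => ((s ∩ fst ⁻¹' {x}).encard : ENNReal)

theorem measure_base_inter {μ : Measure X} (hact : ∀ g : Γ, Measurable fun x : X => g • x)
    (D : Set X) :
    measure ι μ (base ι X ∩ fst ⁻¹' D) = μ (freeOrbitSet ι X ∩ D) := by
  have hemb := MeasurableEmbedding.subtype_coe (measurableSet_cosetSet (ι := ι) hact)
  have h1 : measure ι μ (base ι X ∩ fst ⁻¹' D) =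
      (μ.prod Measure.count) ((Subtype.val : cosetSet ι X → X × ℕ) '' (base ι X ∩ fst ⁻¹' D)) :=
    hemb.comap_apply _ _
  have h2 : (Subtype.val : cosetSet ι X → X × ℕ) '' (base ι X ∩ fst ⁻¹' D) =
      (freeOrbitSet ι X ∩ D) ×ˢ {0} := by
    ext q
    constructor
    · rintro ⟨y, ⟨hy, hyD⟩, rfl⟩
      exact ⟨⟨y.2.1, hyD⟩, hy⟩
    · rintro ⟨⟨h, hD⟩, h0⟩
      have h0' : q.2 = 0 := h0
      exact ⟨⟨q, h, fun i hi => by omega⟩, ⟨h0, hD⟩, rfl⟩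
  rw [h1, h2, Measure.prod_prod, Measure.count_singleton, mul_one]

theorem measure_base {μ : Measure X} [IsProbabilityMeasure μ]
    (hact : ∀ g : Γ, Measurable fun x : X => g • x)
    (hfree : ∀ᵐ x ∂μ, x ∈ freeOrbitSet ι X) : measure ι μ (base ι X) = 1 := by
  have := measure_base_inter (ι := ι) (μ := μ) hact Set.univ
  rw [Set.preimage_univ, Set.inter_univ, Set.inter_univ] at this
  rw [this]
  exact (prob_compl_eq_zero_iff (measurableSet_freeOrbitSet hact)).1 hfree

/-- The coset space with its cocycle into `N`. -/
noncomputable def pmpCocycle (ι : N →* Γ) {μ : Measure X}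
    (hact : ∀ g : Γ, MeasurePreserving (fun x : X => g • x) μ μ) :
    PMPCocycle Γ N (measure ι μ) where
  toFun := cocycle
  measurePreserving := measurePreserving_smul hact
  measurableSet_fiber := measurableSet_cocycle fun g => (hact g).measurable
  map_mul := cocycle_mul

theorem measureReal_base_diff_stepSet_le {μ : Measure X} [IsProbabilityMeasure μ]
    (hact : ∀ g : Γ, MeasurePreserving (fun x : X => g • x) μ μ) (g : Γ) (n : N) :
    (measure ι μ).real (base ι X \ (pmpCocycle ι hact).stepSet (base ι X) g n) ≤
      μ.real {x | g • x ≠ ι n • x} := by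
  have h1 : measure ι μ (base ι X \ (pmpCocycle ι hact).stepSet (base ι X) g n) ≤
      measure ι μ (base ι X ∩ fst ⁻¹' {x | g • x ≠ ι n • x}) := by
    refine measure_mono fun y hy => ⟨hy.1, fun h => hy.2 ?_⟩
    exact ⟨hy.1, smul_mem_base_of_smul_eq hy.1 h⟩
  rw [measure_base_inter fun g => (hact g).measurable] at h1
  refine ENNReal.toReal_mono (measure_ne_top _ _) (h1.trans (measure_mono Set.inter_subset_right))

end Measure

end CosetSpace

end CosetSpace

/-! ## Point realizations of countable subgroups of the full group -/

section Realization

variable {X : Type u}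

open Classical in
/-- The action that is given by the maps `s γ` on `W` and is trivial outside `W`. -/
noncomputable abbrev actionOnSet {Γ : Type*} [Group Γ] (s : Γ → X → X) (W : Set X)
    (hW : ∀ γ, ∀ x ∈ W, s γ x ∈ W) (hone : ∀ x ∈ W, s 1 x = x)
    (hmul : ∀ γ γ', ∀ x ∈ W, s (γ * γ') x = s γ (s γ' x)) : MulAction Γ X where
  smul γ x := if x ∈ W then s γ x else x
  one_smul x := by
    change (if x ∈ W then s 1 x else x) = x
    split_ifs with h
    exacts [hone x h, rfl]
  mul_smul γ γ' x := by
    change (if x ∈ W then s (γ * γ') x else x) =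
      if (if x ∈ W then s γ' x else x) ∈ W then s γ (if x ∈ W then s γ' x else x)
      else (if x ∈ W then s γ' x else x)
    by_cases h : x ∈ W
    · simp [h, hW γ' x h, hmul γ γ' x h]
    · simp [h]

variable [MeasurableSpace X] {μ : Measure X}

open Classical in
theorem MeasurePreserving.ite_of_ae_mem {f : X → X} (hf : MeasurePreserving f μ μ) {W : Set X}
    (hW : MeasurableSet W) (hae : ∀ᵐ x ∂μ, x ∈ W) :
    MeasurePreserving (fun x => if x ∈ W then f x else x) μ μ := by
  refine ⟨Measurable.ite hW hf.measurable measurable_id, ?_⟩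
  rw [Measure.map_congr (g := f) ?_, hf.map_eq]
  filter_upwards [hae] with x hx
  exact if_pos hx

/-- The homomorphism to the group of measure preserving automorphisms given by an action with orbits
in the classes of `E`. -/
def actionHom {E : Setoid X} {N : Type*} [Group N] [MulAction N X]
    (hmp : ∀ n : N, MeasurePreserving (fun x : X => n • x) μ μ) (hE : ∀ (n : N) (x : X), E x (n • x)) :
    N →* PreFullGroup E μ :=
  (MulAction.toPermHom N X).codRestrict (preFullSubgroup E μ) fun n => ⟨hmp n, hmp n⁻¹, hE n⟩

/-- The action is made trivial off the invariant conull set of points whose orbit lies in their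
class. Graphs are then contained in `E` everywhere, and freeness is kept almost everywhere. -/
theorem OrbitallyContains.exists_hom {E : Setoid X} (hE : MeasurableSet {p : X × X | E p.1 p.2})
    {N : Type w} [Group N] [Countable N] (h : OrbitallyContains E μ N) :
    ∃ φ : N →* PreFullGroup E μ, ∀ᵐ x ∂μ, ∀ n, (φ n).toPerm x = x → n = 1 := by
  obtain ⟨_, hmp, hfree, horb⟩ := h
  let W : Set X := {x | ∀ n : N, E x (n • x)}
  have hWm : MeasurableSet W := by
    have : W = ⋂ n : N, {x | E x (n • x)} := by
      ext x
      simp [W]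
    rw [this]
    exact .iInter fun n => hE.preimage (measurable_id.prodMk (hmp n).measurable)
  have hWinv (n : N) (x : X) (hx : x ∈ W) : n • x ∈ W := fun m => by
    rw [← mul_smul]
    exact E.trans (E.symm (hx n)) (hx _)
  let t : N → X → X := fun n x => n • x
  let act : MulAction N X := actionOnSet t W hWinv (fun x _ => one_smul N x)
    fun n m x _ => mul_smul n m x
  classical
  have hact (n : N) (x : X) : n • x = if x ∈ W then t n x else x := by
    change (if x ∈ W then t n x else x) = _
    congr
  refine ⟨@actionHom X _ μ E N _ act (fun n => ?_) fun n x => ?_, ?_⟩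
  · exact MeasurePreserving.ite_of_ae_mem (hmp n) hWm horb
  · rw [hact]
    split_ifs with hx
    exacts [hx n, E.refl x]
  · filter_upwards [hfree, horb] with x hx hxW n hn
    refine hx n ?_
    change n • x = x at hn
    rwa [hact, if_pos (show x ∈ W from hxW)] at hn

variable [IsProbabilityMeasure μ] {E : Setoid X}

theorem PreFullGroup.ae_eq_of_mk_eq [StandardBorelSpace X] {S T : PreFullGroup E μ}
    (h : (SeparationQuotient.mk S : FullGroup E μ) = SeparationQuotient.mk T) :
    ∀ᵐ x ∂μ, S.toPerm x = T.toPerm x := by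
  rw [SeparationQuotient.mk_eq_mk, Metric.inseparable_iff, PreFullGroup.dist_def,
    measureReal_eq_zero_iff] at h
  exact h

/-- A countable subgroup of the full group acts on `X` so that each element acts, up to a null set,
through its representatives. -/
theorem FullGroup.exists_mulAction [StandardBorelSpace X] (Γ : Subgroup (FullGroup E μ))
    [Countable Γ] : ∃ _ : MulAction Γ X,
      (∀ γ : Γ, MeasurePreserving (fun x : X => γ • x) μ μ) ∧
      ∀ (γ : Γ) (T : PreFullGroup E μ), SeparationQuotient.mk T = (γ : FullGroup E μ) →
        ∀ᵐ x ∂μ, γ • x = T.toPerm x := by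
  choose s hs using fun γ : Γ => SeparationQuotient.surjective_mk (γ : FullGroup E μ)
  have hmp (γ : Γ) : MeasurePreserving (s γ).toPerm μ μ := (s γ).2.1
  let W₁ : Set X := {x | ∀ γ γ' : Γ, (s (γ * γ')).toPerm x = (s γ).toPerm ((s γ').toPerm x)}
  -- Multiplicativity of the representatives on `W₁` makes `W` invariant: `s γ' (s γ x) = s (γ' * γ)
  -- x` lies in `W₁` again. Countability of `Γ` makes `W` conull.
  let W : Set X := W₁ ∩ {x | ∀ γ : Γ, (s γ).toPerm x ∈ W₁}
  have hW₁m : MeasurableSet W₁ := by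
    have : W₁ = ⋂ γ : Γ, ⋂ γ' : Γ,
        {x | (s (γ * γ')).toPerm x = (s γ).toPerm ((s γ').toPerm x)} := by
      ext x
      simp [W₁]
    rw [this]
    exact .iInter fun γ => .iInter fun γ' => measurableSet_eq_fun (hmp _).measurable
      ((hmp _).measurable.comp (hmp _).measurable)
  have hWm : MeasurableSet W := by
    refine hW₁m.inter ?_
    have : {x | ∀ γ : Γ, (s γ).toPerm x ∈ W₁} = ⋂ γ : Γ, (s γ).toPerm ⁻¹' W₁ := by
      ext x
      simp
    rw [this]
    exact .iInter fun γ => (hmp γ).measurable hW₁m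
  have hW₁ae : ∀ᵐ x ∂μ, x ∈ W₁ := by
    refine ae_all_iff.2 fun γ => ae_all_iff.2 fun γ' => ?_
    refine PreFullGroup.ae_eq_of_mk_eq (S := s (γ * γ')) (T := s γ * s γ') ?_
    rw [SeparationQuotient.mk_mul, hs, hs, hs, Subgroup.coe_mul]
  have hWae : ∀ᵐ x ∂μ, x ∈ W := by
    refine hW₁ae.and (ae_all_iff.2 fun γ => ?_)
    exact (hmp γ).quasiMeasurePreserving.ae hW₁ae
  have hWinv (γ : Γ) (x : X) (hx : x ∈ W) : (s γ).toPerm x ∈ W := by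
    refine ⟨hx.2 γ, fun γ' => ?_⟩
    rw [← hx.1 γ' γ]
    exact hx.2 _
  have hone (x : X) (hx : x ∈ W) : (s 1).toPerm x = x := by
    have := hx.1 1 1
    rw [one_mul] at this
    exact ((s 1).toPerm.injective this).symm
  let act : MulAction Γ X := actionOnSet (fun γ x => (s γ).toPerm x) W hWinv hone
    fun γ γ' x hx => hx.1 γ γ'
  classical
  refine ⟨act, fun γ => ?_, fun γ T hT => ?_⟩
  · exact MeasurePreserving.ite_of_ae_mem (hmp γ) hWm hWae
  · filter_upwards [hWae, PreFullGroup.ae_eq_of_mk_eq ((hs γ).trans hT.symm)] with x hx hxT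
    exact (if_pos hx).trans hxT

/-- A measured cocycle of a group containing a dense subgroup `G` of the full group, in which the
elements of `N` are approximated by the elements of `G`. -/
theorem exists_pmpCocycle_of_dense [StandardBorelSpace X] (hE : IsCountablePMPRelation E μ)
    (G : Subgroup (FullGroup E μ)) [Countable G] (hG : Dense (G : Set (FullGroup E μ)))
    {N : Type w} [Group N] [Countable N] (h : OrbitallyContains E μ N) :
    ∃ (Γ : Type u) (_ : Group Γ) (Y : Type u) (_ : MulAction Γ Y) (_ : MeasurableSpace Y)
      (ν : Measure Y) (α : PMPCocycle Γ N ν) (j : G →* Γ) (Y₀ : Set Y) (S : N → ℕ → G),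
      MeasurableSet Y₀ ∧ ν Y₀ = 1 ∧ ∀ n, Filter.Tendsto
        (fun k => ν.real (Y₀ \ α.stepSet Y₀ (j (S n k)) n)) Filter.atTop (nhds 0) := by
  obtain ⟨φ, hφ⟩ := h.exists_hom hE.measurableSet
  let ψ : N →* FullGroup E μ := SeparationQuotient.mkMonoidHom.comp φ
  -- As the image of a countable free group, the subgroup generated by `G` and `N` is visibly
  -- countable, and it stays in the universe of `X`.
  let p : FreeGroup (G ⊕ N) →* FullGroup E μ := FreeGroup.lift (Sum.elim Subtype.val ψ)
  let Γ : Subgroup (FullGroup E μ) := p.range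
  have : Countable Γ := (Set.countable_range p).to_subtype
  let j : G →* Γ := G.subtype.codRestrict Γ fun g => ⟨FreeGroup.of (Sum.inl g), by simp [p]⟩
  let ι : N →* Γ := ψ.codRestrict Γ fun n => ⟨FreeGroup.of (Sum.inr n), by simp [p]⟩
  obtain ⟨_, hmp, hrep⟩ := FullGroup.exists_mulAction Γ
  have hι : ∀ᵐ x ∂μ, ∀ n : N, ι n • x = (φ n).toPerm x :=
    ae_all_iff.2 fun n => hrep (ι n) (φ n) rfl
  have hfree : ∀ᵐ x ∂μ, x ∈ freeOrbitSet ι X := by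
    have h1 : ∀ᵐ x ∂μ, ∀ n : N, ι n • x = x → n = 1 := by
      filter_upwards [hφ, hι] with x hx hxι n hn
      exact hx n (hxι n ▸ hn)
    -- Freeness at almost every point pulls back along each of the countably many `γ`, which gives
    -- freeness along whole `Γ`-orbits.
    exact ae_all_iff.2 fun γ => (hmp γ).quasiMeasurePreserving.ae h1
  have happ (n : N) (k : ℕ) : ∃ g : G, μ.real {x | j g • x ≠ ι n • x} < 1 / ((k : ℝ) + 1) := by
    obtain ⟨g, hg, hd⟩ := hG.exists_dist_lt (ψ n) (ε := 1 / ((k : ℝ) + 1)) (by positivity)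
    obtain ⟨T, rfl⟩ := SeparationQuotient.surjective_mk g
    refine ⟨⟨_, hg⟩, lt_of_eq_of_lt ?_ hd⟩
    change _ = dist (SeparationQuotient.mk (φ n)) (SeparationQuotient.mk T)
    rw [SeparationQuotient.dist_mk, dist_comm, PreFullGroup.dist_def]
    refine measureReal_congr ?_
    filter_upwards [hι, hrep (j ⟨_, hg⟩) T rfl] with x h1 h2
    change (_ ≠ _) = (_ ≠ _)
    rw [h1, h2]
  choose S hS using happ
  refine ⟨Γ, inferInstance, CosetSpace ι X, inferInstance, inferInstance, CosetSpace.measure ι μ,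
    CosetSpace.pmpCocycle ι hmp, j, CosetSpace.base ι X, S, CosetSpace.measurableSet_base,
    CosetSpace.measure_base (fun g => (hmp g).measurable) hfree, fun n => ?_⟩
  exact squeeze_zero (fun k => measureReal_nonneg)
    (fun k => (CosetSpace.measureReal_base_diff_stepSet_le hmp _ n).trans (hS n k).le)
    tendsto_one_div_add_atTop_nhds_zero_nat

end Realization

theorem theorem4 {X : Type u} [MeasurableSpace X] [StandardBorelSpace X]
    (μ : Measure X) [IsProbabilityMeasure μ]
    (E : Setoid X) (hE : IsCountablePMPRelation E μ)
    (G : Subgroup (FullGroup E μ)) [Countable G] (hG : Dense (G : Set (FullGroup E μ))) :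
    ((∃ (N : Type w) (_ : Group N), Countable N ∧ OrbitallyContains E μ N ∧
        ¬ UnitarizableGroup.{max u v, w} N) →
      ¬ UnitarizableGroup.{max u v, u} G) ∧
    ((∃ (N : Type w) (_ : Group N), Countable N ∧ OrbitallyContains E μ N ∧
        HasNotStronglyRigidRep.{max u v, w} N) →
      HasNotStronglyRigidRep.{max u v, u} G) := by
  constructor
  · rintro ⟨N, _, _, hEN, hN⟩ hGu
    obtain ⟨Γ, _, Y, _, _, ν, α, j, Y₀, S, h₀, hν₀, hS⟩ := exists_pmpCocycle_of_dense hE G hG hEN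
    exact hN (α.unitarizableGroup_of_tendsto.{u, v, w} j h₀ hν₀ hS hGu)
  · rintro ⟨N, _, _, hEN, hN⟩
    obtain ⟨Γ, _, Y, _, _, ν, α, j, Y₀, S, h₀, hν₀, hS⟩ := exists_pmpCocycle_of_dense hE G hG hEN
    exact α.hasNotStronglyRigidRep_of_tendsto.{u, v, w} j h₀ hν₀ hS hN
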